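/- Let $\mathcal C_2$ be the comb: the graph with vertex set $\mathbb Z^2$ in which $(x,y)$ and $(x',y')$ are adjacent if and only if either $x=x'$ and $|y-y'|=1$, or $y=y'=0$ and $|x-x'|=1$. A rotor sequence assigns to every vertex $v$ a cyclic ordering $(v_0,\dots,v_{d(v)-1})$ of its neighbours, where $d(v)$ is the degree of $v$, and a rotor configuration $\rho$ assigns to every vertex $v$ one of its neighbours $\rho(v)$. A particle performing a rotor-router walk and located at $v$ with $\rho(v)=v_i$ first resets $\rho(v)$ to $v_{i+1}$ (indices modulo $d(v)$) and then moves to $v_{i+1}$. In rotor-router aggregation, particles start one after another at the origin $o=(0,0)$; each performs a rotor-router walk until it first reaches a vertex that is not yet occupied, where it stops and which it occupies, and the rotors are not reset between particles. The first particle occupies $o$. The set $R_n$ of vertices occupied by the first $n$ particles is the rotor-router cluster; it depends on the rotor sequence and on the initial rotor configuration. **Theorem.** Let $k=\left(\tfrac32\right)^{2/3}$ and $l=\tfrac12\left(\tfrac32\right)^{1/3}$. There are constants $c_1,c_2,c_3>0$ and $n_0\in\mathbb N$ such that for every $n\ge n_0$, every rotor sequence and every initial rotor configuration on $\mathcal C_2$,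 $$\Big\{(x,y)\in\mathbb Z^2:\ |x|\le k\,n^{1/3}-c_1 n^{1/6},\quad |y|\le l\Big(n^{1/3}-\frac{|x|}{k}\Big)^2+c_2|x|-c_3 n^{1/3}\Big\}\subseteq R_n .$$ -/

import Mathlib

noncomputable section

namespace RotorRouter

/-- A rotor sequence on `G`: for every vertex `v` an enumeration
`c(v) = (v_0, …, v_{d(v)-1})` of its neighbours, where `d(v)` is the degree of `v`. -/
abbrev RotorSequence {V : Type*} (G : SimpleGraph V) : Type _ :=
  ∀ v : V, Fin (Nat.card (G.neighborSet v)) ≃ G.neighborSet v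

/-- A rotor configuration on `G` assigns to every vertex one of its neighbours. -/
abbrev RotorConfig {V : Type*} (G : SimpleGraph V) : Type _ :=
  ∀ v : V, G.neighborSet v

/-- The neighbour of `v` that follows `w` in the cyclic order `c(v)`: `v_i` is sent to `v_{i+1}`,
with `i + 1` taken modulo `d(v)` (`finRotate d` is the map `i ↦ i + 1 mod d` on `Fin d`). -/
def nextNeighbor {V : Type*} {G : SimpleGraph V} (c : RotorSequence G) (v : V)
    (w : G.neighborSet v) : G.neighborSet v :=
  c v (finRotate _ ((c v).symm w))

open Classical in
/-- One step of a rotor-router walk. The state is the position `v` of the particle together with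
the current rotor configuration. First the rotor at `v` is moved to the next neighbour, then the
particle moves to the neighbour the rotor is now pointing at. -/
def walkStep {V : Type*} {G : SimpleGraph V} (c : RotorSequence G)
    (s : V × RotorConfig G) : V × RotorConfig G :=
  ((nextNeighbor c s.1 (s.2 s.1) : V),
    Function.update s.2 s.1 (nextNeighbor c s.1 (s.2 s.1)))

/-- The number of steps after which the rotor-router walk started in the state `s` is outside of
`A` for the first time. (On an infinite connected locally finite graph the walk leaves every
finite set `A`; otherwise the infimum of the empty set is `0`.) -/
def exitTime {V : Type*} {G : SimpleGraph V} (c : RotorSequence G) (A : Set V)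
    (s : V × RotorConfig G) : ℕ :=
  sInf {t : ℕ | ((walkStep c)^[t] s).1 ∉ A}

/-- The state of a particle started at `o`, with rotors `ρ`, at the moment it first leaves `A`:
its position and the rotor configuration it leaves behind. -/
def exitState {V : Type*} {G : SimpleGraph V} (c : RotorSequence G) (o : V) (A : Set V)
    (ρ : RotorConfig G) : V × RotorConfig G :=
  (walkStep c)^[exitTime c A (o, ρ)] (o, ρ)

/-- Rotor-router aggregation at `o` with initial rotors `ρ₀`: the set of occupied sites and the
rotor configuration after `n` particles. Each particle starts at `o` and stops at the first vertex
that is not yet occupied; the rotors are not reset. The first particle stops at `o` at once. -/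
def aggregation {V : Type*} {G : SimpleGraph V} (c : RotorSequence G) (o : V)
    (ρ₀ : RotorConfig G) : ℕ → Set V × RotorConfig G
  | 0 => (∅, ρ₀)
  | n + 1 =>
    (insert (exitState c o (aggregation c o ρ₀ n).1 (aggregation c o ρ₀ n).2).1
        (aggregation c o ρ₀ n).1,
      (exitState c o (aggregation c o ρ₀ n).1 (aggregation c o ρ₀ n).2).2)

/-- The rotor-router cluster `R_n` of `n` particles. -/
def cluster {V : Type*} {G : SimpleGraph V} (c : RotorSequence G) (o : V)
    (ρ₀ : RotorConfig G) (n : ℕ) : Set V :=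
  (aggregation c o ρ₀ n).1

/-- The comb `C_2` on the vertex set `ℤ × ℤ`: all vertical edges of the square lattice, and those
horizontal edges that lie on the `x`-axis. -/
def comb : SimpleGraph (ℤ × ℤ) where
  Adj p q := (p.1 = q.1 ∧ |p.2 - q.2| = 1) ∨ (p.2 = 0 ∧ q.2 = 0 ∧ |p.1 - q.1| = 1)
  symm := ⟨by
    rintro p q (⟨h, h'⟩ | ⟨h, h', h''⟩)
    · exact Or.inl ⟨h.symm, by rw [abs_sub_comm]; exact h'⟩
    · exact Or.inr ⟨h', h, by rw [abs_sub_comm]; exact h''⟩⟩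
  loopless := ⟨by
    rintro p (⟨_, h⟩ | ⟨_, _, h⟩) <;> simp at h⟩

/-- The constant `k = (3/2)^(2/3)`. -/
def k : ℝ := (3 / 2 : ℝ) ^ (2 / 3 : ℝ)

/-- The constant `l = (1/2) (3/2)^(1/3)`. -/
def l : ℝ := (1 / 2 : ℝ) * (3 / 2 : ℝ) ^ (1 / 3 : ℝ)

/-- The set of points `(x, y)` of the comb with `|x| ≤ k n^(1/3) - c₁ n^(1/6)` and
`|y| ≤ l (n^(1/3) - |x|/k)^2 + c₂ |x| - c₃ n^(1/3)`. -/
def innerRegion (c₁ c₂ c₃ : ℝ) (n : ℕ) : Set (ℤ × ℤ) :=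
  {z | |(z.1 : ℝ)| ≤ k * (n : ℝ) ^ (1 / 3 : ℝ) - c₁ * (n : ℝ) ^ (1 / 6 : ℝ) ∧
    |(z.2 : ℝ)| ≤ l * ((n : ℝ) ^ (1 / 3 : ℝ) - |(z.1 : ℝ)| / k) ^ 2
      + c₂ * |(z.1 : ℝ)| - c₃ * (n : ℝ) ^ (1 / 3 : ℝ)}

end RotorRouter

end

/-! The comb is a tree, so every edge is a bridge and, once a particle has settled, the net number
of crossings of an edge equals the number of occupied sites behind it. Rotors make the crossings
from a vertex to any two neighbours differ by at most one, whatever the rotor order and initial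
rotors. `Ledger` records these two laws. On a tooth with `h` occupied sites on one side, summing
them from the tip down gives about `h ^ 2 / 2` crossings at its foot (`ray_flow`). On the backbone,
counted inward from the last occupied site, let `a` be the outward crossings and `S` the sites
beyond. Then `a' ≈ S` and `S' ≈ 2 √(2 a)`, so `a ≈ t ^ 4 / 18`, `S ≈ 2 t ^ 3 / 9`, and a tooth at
distance `t` from the end has height about `t ^ 2 / 3`. Two barriers make this rigorous with bounded
shifts in `t` (`Ledger.exists_extent`). The two sides send nearly equal flow from the origin, so
they have nearly equal length `r`, and `n ≤ (4 / 9) (r + 9) ^ 3` (`Ledger.exists_long_extent`).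
Hence `r ≥ k n ^ (1 / 3) - 9`, and the lower barrier bounds every tooth from below. -/

namespace RotorRouter

/-! ### Cyclic rotor positions -/

section Lag

/-- The number of rotations that take the index `i` to the index `j` in `Fin d`. -/
def lag {d : ℕ} (j i : Fin d) : ℕ := (j + (d - i)) % d

theorem lag_lt {d : ℕ} (j i : Fin d) : lag j i < d :=
  Nat.mod_lt _ (by have := i.2; omega)

theorem val_finRotate {d : ℕ} (j : Fin d) : (finRotate d j : ℕ) = (j + 1) % d := by
  cases d with
  | zero => exact j.elim0
  | succ d => simp [finRotate_apply, Fin.val_add]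

/-- Each rotation raises the lag by one, except that it wraps from `d - 1` to `0` on reaching `i`.
Hence `d` times the visits to `i`, plus the lag, grows by exactly one per step, which is the
invariant `Ledger.rotor`. -/
theorem lag_finRotate {d : ℕ} (j i : Fin d) :
    lag (finRotate d j) i + (if finRotate d j = i then d else 0) = lag j i + 1 := by
  have hi := i.2
  have hj := j.2
  have hv := val_finRotate j
  unfold lag
  by_cases hjd : (j : ℕ) + 1 = d
  · have h0 : (finRotate d j : ℕ) = 0 := by rw [hv, hjd, Nat.mod_self]
    rw [h0]
    by_cases hi0 : (i : ℕ) = 0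
    · rw [if_pos (Fin.ext (by omega)), hi0]
      simp [Nat.mod_eq_of_lt hj]
      omega
    · rw [if_neg (fun h => hi0 (by rw [← h, h0])), Nat.mod_eq_of_lt (by omega),
        Nat.mod_eq_sub_mod (by omega), Nat.mod_eq_of_lt (by omega)]
      omega
  · have h0 : (finRotate d j : ℕ) = j + 1 := by rw [hv, Nat.mod_eq_of_lt (by omega)]
    rw [h0]
    by_cases hij : (i : ℕ) = j + 1
    · rw [if_pos (Fin.ext (by omega)), hij,
        show (j : ℕ) + 1 + (d - (j + 1)) = d by omega, Nat.mod_self,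
        Nat.mod_eq_of_lt (by omega)]
      omega
    · rw [if_neg (fun h => hij (by rw [← h, h0]))]
      rcases Nat.lt_or_ge (j : ℕ) i with h | h
      · rw [Nat.mod_eq_of_lt (by omega), Nat.mod_eq_of_lt (by omega)]
        omega
      · rw [Nat.mod_eq_sub_mod (by omega), Nat.mod_eq_of_lt (by omega),
          Nat.mod_eq_sub_mod (by omega), Nat.mod_eq_of_lt (by omega)]
        omega

end Lag

/-! ### Conservation laws of rotor-router aggregation -/

section Ledger

variable {V : Type*} {G : SimpleGraph V}

open Classical in
/-- The book-keeping of a rotor-router aggregation at `o` with initial rotors `ρ₀`, at a moment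
when the sites of `A` are occupied and the current particle and the rotors are in the state `s`:
`u v` is the number of steps made from `v` so far and `e v w` the number of those that led
to `w`. -/
structure Ledger (c : RotorSequence G) (o : V) (ρ₀ : RotorConfig G) (A : Finset V)
    (s : V × RotorConfig G) (u : V → ℕ) (e : V → V → ℕ) : Prop where
  rotor : ∀ v i, Nat.card (G.neighborSet v) * e v (c v i) + lag ((c v).symm (s.2 v)) i
    = u v + lag ((c v).symm (ρ₀ v)) i
  cut : ∀ (B : Set V) (p q : V), o ∉ B → p ∉ B → q ∈ B →
    (∀ v w, G.Adj v w → v ∉ B → w ∈ B → v = p ∧ w = q) →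
    e p q = e q p + {v ∈ A | v ∈ B}.card + if s.1 ∈ B then 1 else 0
  steps_eq_zero : ∀ v ∉ A, u v = 0
  crossings_eq_zero : ∀ v ∉ A, ∀ w, e v w = 0

variable {c : RotorSequence G} {o : V} {ρ₀ : RotorConfig G} {A : Finset V}
  {s : V × RotorConfig G} {u : V → ℕ} {e : V → V → ℕ}

theorem Ledger.initial (c : RotorSequence G) (o : V) (ρ₀ : RotorConfig G) :
    Ledger c o ρ₀ ∅ (o, ρ₀) 0 0 where
  rotor := by simp
  cut := by
    intro B p q ho _ _ _
    simp [ho]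
  steps_eq_zero := by simp
  crossings_eq_zero := by simp

-- For `cut`, a step changes membership in `B` only along the bridge `p q`; the crossing counts then
-- absorb the change. The hypothesis `hs` keeps unoccupied vertices free of departures.
open Classical in
theorem Ledger.step (h : Ledger c o ρ₀ A s u e) (hs : s.1 ∈ A) :
    Ledger c o ρ₀ A (walkStep c s) (fun v => u v + if v = s.1 then 1 else 0)
      (fun v w => e v w + if v = s.1 ∧ w = (walkStep c s).1 then 1 else 0) where
  rotor := by
    intro v i
    have h1 := h.rotor v i
    by_cases hv : v = s.1
    · subst hv
      have h2 := lag_finRotate ((c s.1).symm (s.2 s.1)) i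
      have hiff : ((c s.1 i : V) = (walkStep c s).1) ↔
          finRotate _ ((c s.1).symm (s.2 s.1)) = i := by
        simp only [walkStep, nextNeighbor, Subtype.coe_inj, EmbeddingLike.apply_eq_iff_eq]
        exact eq_comm
      have h3 : (c s.1).symm ((walkStep c s).2 s.1)
          = finRotate _ ((c s.1).symm (s.2 s.1)) := by
        simp only [walkStep, nextNeighbor, Function.update_self]
        exact Equiv.symm_apply_apply _ _
      rw [h3]
      simp only [true_and, if_true, hiff]
      split_ifs at h2 ⊢
      · rw [mul_add]; omega
      · rw [add_zero]; omega
    · have h3 : (walkStep c s).2 v = s.2 v := by simp [walkStep, hv]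
      rw [h3]
      simpa [hv] using h1
  cut := by
    intro B p q ho hp hq hB
    have h1 := h.cut B p q ho hp hq hB
    have hadj : G.Adj s.1 (walkStep c s).1 := (nextNeighbor c s.1 (s.2 s.1)).2
    generalize (walkStep c s).1 = w at hadj ⊢
    generalize s.1 = v at hadj h1 ⊢
    have hpq : p ≠ q := fun h => hp (h ▸ hq)
    by_cases hv : v ∈ B <;> by_cases hw : w ∈ B
    · have h2 : ¬ (p = v ∧ q = w) := fun h => hp (h.1 ▸ hv)
      have h3 : ¬ (q = v ∧ p = w) := fun h => hp (h.2 ▸ hw)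
      simp only [h2, h3, hv, hw, if_true, if_false] at h1 ⊢
      omega
    · obtain ⟨rfl, rfl⟩ := hB w v hadj.symm hw hv
      simp only [hpq, hpq.symm, hv, hw, if_true, if_false, and_self] at h1 ⊢
      omega
    · obtain ⟨rfl, rfl⟩ := hB v w hadj hv hw
      simp only [hpq, hpq.symm, hv, hw, if_true, if_false, and_self] at h1 ⊢
      omega
    · have h2 : ¬ (p = v ∧ q = w) := fun h => hw (h.2 ▸ hq)
      have h3 : ¬ (q = v ∧ p = w) := fun h => hv (h.1 ▸ hq)
      simp only [h2, h3, hv, hw, if_false] at h1 ⊢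
      omega
  steps_eq_zero := by
    intro v hv
    have : v ≠ s.1 := fun h => hv (h ▸ hs)
    simp [h.steps_eq_zero v hv, this]
  crossings_eq_zero := by
    intro v hv w
    have : v ≠ s.1 := fun h => hv (h ▸ hs)
    simp [h.crossings_eq_zero v hv w, this]

open Classical in
theorem Ledger.settle (h : Ledger c o ρ₀ A s u e) (hs : s.1 ∉ A) :
    Ledger c o ρ₀ (insert s.1 A) (o, s.2) u e where
  rotor := h.rotor
  cut := by
    intro B p q ho hp hq hB
    have h1 := h.cut B p q ho hp hq hB
    rw [Finset.filter_insert]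
    by_cases hsB : s.1 ∈ B
    · rw [if_pos hsB, Finset.card_insert_of_notMem (by simp [hs]), if_neg ho]
      rw [if_pos hsB] at h1
      omega
    · rw [if_neg hsB, if_neg ho]
      rwa [if_neg hsB] at h1
  steps_eq_zero := fun v hv => h.steps_eq_zero v fun h' => hv (Finset.mem_insert_of_mem h')
  crossings_eq_zero := fun v hv =>
    h.crossings_eq_zero v fun h' => hv (Finset.mem_insert_of_mem h')

/-- Subtracting the rotor identities of the two neighbours cancels `u v` and leaves four lags below
`d`, so `d` times the difference is less than `2 d`. -/
theorem Ledger.crossings_le (h : Ledger c o ρ₀ A s u e) {v w w' : V} (hw : G.Adj v w)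
    (hw' : G.Adj v w') : e v w ≤ e v w' + 1 := by
  obtain ⟨i, hi⟩ := (c v).surjective ⟨w, hw⟩
  obtain ⟨j, hj⟩ := (c v).surjective ⟨w', hw'⟩
  have h1 := h.rotor v i
  have h2 := h.rotor v j
  rw [hi] at h1
  rw [hj] at h2
  dsimp only at h1 h2
  have b1 := lag_lt ((c v).symm (ρ₀ v)) i
  have b2 := lag_lt ((c v).symm (s.2 v)) j
  by_contra hlt
  have h3 : Nat.card (G.neighborSet v) * (e v w' + 2) ≤ Nat.card (G.neighborSet v) * e v w :=
    Nat.mul_le_mul_left _ (by omega)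
  rw [mul_add] at h3
  omega

theorem Ledger.steps_le (h : Ledger c o ρ₀ A s u e) {v w : V} (hw : G.Adj v w) :
    u v ≤ Nat.card (G.neighborSet v) * (e v w + 1) := by
  obtain ⟨i, hi⟩ := (c v).surjective ⟨w, hw⟩
  have h1 := h.rotor v i
  rw [hi] at h1
  dsimp only at h1
  have b1 := lag_lt ((c v).symm (s.2 v)) i
  rw [mul_add]
  omega

open Classical in
theorem Ledger.exists_iterate (h : Ledger c o ρ₀ A s u e) (t : ℕ)
    (ht : ∀ t' < t, ((walkStep c)^[t'] s).1 ∈ A) :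
    ∃ u' e', Ledger c o ρ₀ A ((walkStep c)^[t] s) u' e' ∧
      ∑ v ∈ A, u' v = ∑ v ∈ A, u v + t := by
  induction t with
  | zero => exact ⟨u, e, h, rfl⟩
  | succ t ih =>
    obtain ⟨u', e', h', hsum⟩ := ih fun t' ht' => ht t' (by omega)
    have hstep := h'.step (ht t (by omega))
    rw [← Function.iterate_succ_apply' (walkStep c)] at hstep
    refine ⟨_, _, hstep, ?_⟩
    rw [Finset.sum_add_distrib, hsum, Finset.sum_ite_eq' A, if_pos (ht t (by omega)), add_assoc]

open Classical in
/-- If the number of steps made inside a finite set is bounded, every particle settles, and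
the cluster comes with a ledger. -/
theorem exists_ledger (c : RotorSequence G) (o : V) (ρ₀ : RotorConfig G)
    (hbound : ∀ A : Finset V, ∃ K, ∀ s u e, Ledger c o ρ₀ A s u e → ∑ v ∈ A, u v ≤ K) (n : ℕ) :
    ∃ (A : Finset V) (u : V → ℕ) (e : V → V → ℕ), cluster c o ρ₀ n = ↑A ∧ A.card = n ∧ (n ≠ 0 → o ∈ A) ∧
      Ledger c o ρ₀ A (o, (aggregation c o ρ₀ n).2) u e := by
  induction n with
  | zero => exact ⟨∅, 0, 0, by simp [cluster, aggregation], rfl, by simp, Ledger.initial c o ρ₀⟩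
  | succ n ih =>
    obtain ⟨A, u, e, hA, hcard, ho, h⟩ := ih
    have hagg : (aggregation c o ρ₀ n).1 = ↑A := hA
    obtain ⟨K, hK⟩ := hbound A
    set s : V × RotorConfig G := (o, (aggregation c o ρ₀ n).2) with hs
    -- An empty set would give `exitTime` the default value `0`. It is excluded because a particle
    -- staying in `A` for `K + 1` steps would exceed the bound on `∑ u`.
    have hne : {t : ℕ | ((walkStep c)^[t] s).1 ∉ (A : Set V)}.Nonempty := by
      by_contra hemp
      rw [Set.not_nonempty_iff_eq_empty, Set.eq_empty_iff_forall_notMem] at hemp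
      obtain ⟨u', e', h', hsum⟩ := h.exists_iterate (K + 1) fun t _ => by
        simpa using hemp t
      have := hK _ _ _ h'
      omega
    have hexit : ((walkStep c)^[exitTime c A s] s).1 ∉ (A : Set V) := Nat.sInf_mem hne
    obtain ⟨u', e', h', -⟩ := h.exists_iterate (exitTime c A s) fun t ht => by
      simpa using Nat.notMem_of_lt_sInf ht
    have hfin := h'.settle (by simpa using hexit)
    have hnext : aggregation c o ρ₀ (n + 1) =
        (insert ((walkStep c)^[exitTime c A s] s).1 (A : Set V),
          ((walkStep c)^[exitTime c A s] s).2) := by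
      simp only [aggregation, exitState, hagg, hs]
    refine ⟨insert ((walkStep c)^[exitTime c A s] s).1 A, u', e', ?_, ?_, ?_, ?_⟩
    · rw [cluster, hnext, Finset.coe_insert]
    · rw [Finset.card_insert_of_notMem (by simpa using hexit), hcard]
    · intro _
      rcases Nat.eq_zero_or_pos n with rfl | hn
      · have hA0 : A = ∅ := Finset.card_eq_zero.mp hcard
        have h0 : exitTime c A s = 0 := by
          apply Nat.sInf_eq_zero.mpr
          left
          simp [hA0]
        rw [h0]
        simp [hs]
      · exact Finset.mem_insert_of_mem (ho (by omega))
    · rw [hnext]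
      exact hfin

end Ledger



/-! ### Barriers for the discrete differential inequality -/

section Analysis

theorem height_le {h a t : ℝ} (ht : 3 ≤ t) (h1 : h * (h - 1) ≤ 2 * a + 2)
    (ha : a ≤ t ^ 4 / 18 - t ^ 2 / 2) : h ≤ t ^ 2 / 3 - 1 := by
  by_contra hlt
  push Not at hlt
  have h9 : 9 ≤ t ^ 2 := by nlinarith
  have h2 : (t ^ 2 / 3 - 1) * (t ^ 2 / 3 - 2) < h * (h - 1) := by
    apply mul_lt_mul'' <;> linarith
  have h3 : (t ^ 2 / 3 - 1) * (t ^ 2 / 3 - 2) = t ^ 4 / 9 - t ^ 2 + 2 := by ring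
  linarith

theorem le_height {h a t : ℝ} (hh : 0 ≤ h) (h1 : 2 * a - 2 ≤ h * (h + 3))
    (ha : t ^ 4 / 18 + 2 * t ^ 2 / 3 + 2 ≤ a) : t ^ 2 / 3 + 1 / 2 ≤ h := by
  by_contra hlt
  push Not at hlt
  have h2 : h * (h + 3) < (t ^ 2 / 3 + 1 / 2) * (t ^ 2 / 3 + 7 / 2) := by
    apply mul_lt_mul'' <;> linarith
  have h3 : (t ^ 2 / 3 + 1 / 2) * (t ^ 2 / 3 + 7 / 2) = t ^ 4 / 9 + 4 * t ^ 2 / 3 + 7 / 4 := by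
    ring
  linarith

/-- A discrete comparison principle: solutions of `a'' ≤ 2 √(2 a) + O(1)` with zero initial data
stay below a shifted copy of `t ^ 4 / 18 - t ^ 2 / 2`. -/
theorem upper_barrier {r : ℕ} {a S T : ℕ → ℝ} (ha0 : a 0 = 0) (hS0 : S 0 = 0)
    (hS : ∀ i < r, S (i + 1) = S i + T i) (ha : ∀ i < r, a (i + 1) ≤ a i + S (i + 1) + 1)
    (hT : ∀ i ≤ r, ∀ t : ℝ, 3 ≤ t → a i ≤ t ^ 4 / 18 - t ^ 2 / 2 → T i ≤ 2 / 3 * t ^ 2 - 1)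
    {i : ℕ} (hi : i ≤ r) :
    a i ≤ ((i : ℝ) + 3) ^ 4 / 18 - ((i : ℝ) + 3) ^ 2 / 2 ∧
    S i ≤ (4 * ((i : ℝ) + 3) ^ 3 - 6 * ((i : ℝ) + 3) ^ 2 + 4 * ((i : ℝ) + 3) - 1) / 18
      - ((i : ℝ) + 3) - 1 / 2 := by
  -- The barrier vanishes at `t = 3`, whence the shift. The bound on `S` is the backward difference
  -- of the barrier minus one, to absorb the error in `ha`; the term `- t ^ 2 / 2` pays for
  -- lower-order errors.
  induction i with
  | zero => rw [ha0, hS0]; norm_num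
  | succ i ih =>
    obtain ⟨h1, h2⟩ := ih (by omega)
    have h3 := hT i (by omega) (i + 3) (by linarith [(i.cast_nonneg : (0 : ℝ) ≤ i)]) h1
    have h4 := hS i (by omega)
    have h5 := ha i (by omega)
    push_cast
    constructor <;> nlinarith

/-- A discrete comparison principle: solutions of `a'' ≥ 2 √(2 a) - O(1)` with positive forcing
stay above a shifted copy of `t ^ 4 / 18 + 2 t ^ 2 / 3 + 2`. -/
theorem lower_barrier {r : ℕ} {a S T : ℕ → ℝ} (ha0 : ∀ i ≤ r, 0 ≤ a i) (hS0 : S 0 = 0)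
    (hS : ∀ i < r, S (i + 1) = S i + T i) (ha : ∀ i < r, a i + S (i + 1) - 1 ≤ a (i + 1))
    (hT1 : ∀ i ≤ r, 1 ≤ T i)
    (hT : ∀ i ≤ r, ∀ t : ℝ, t ^ 4 / 18 + 2 * t ^ 2 / 3 + 2 ≤ a i → 2 / 3 * t ^ 2 + 2 ≤ T i)
    {i : ℕ} (hi : i + 3 ≤ r) :
    (i : ℝ) ^ 4 / 18 + 2 * (i : ℝ) ^ 2 / 3 + 2 ≤ a (i + 3) ∧
    (4 * (i : ℝ) ^ 3 - 6 * (i : ℝ) ^ 2 + 4 * i - 1) / 18 + 2 * (2 * (i : ℝ) - 1) / 3 + 1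
      ≤ S (i + 3) := by
  -- Zero data also allow the solution `a = 0` of the limiting equation. The forcing `hT1` excludes
  -- it: after three steps `a` and `S` are both at least `3`, above the barrier at `t = 0`.
  induction i with
  | zero =>
    have := ha0 1 (by omega)
    have := hT1 0 (by omega)
    have := hT1 1 (by omega)
    have := hT1 2 (by omega)
    have s1 := hS 0 (by omega)
    have s2 := hS 1 (by omega)
    have s3 := hS 2 (by omega)
    have a2 := ha 1 (by omega)
    have a3 := ha 2 (by omega)
    norm_num at *
    constructor <;> linarith
  | succ i ih =>
    obtain ⟨h1, h2⟩ := ih (by omega)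
    have h3 := hT (i + 3) (by omega) i h1
    have h4 := hS (i + 3) (by omega)
    have h5 := ha (i + 3) (by omega)
    rw [show i + 1 + 3 = i + 3 + 1 by ring]
    push_cast
    constructor <;> nlinarith

end Analysis

/-! ### Flow along one side of a tooth -/

section Tooth

/-- The flow along a ray whose vertices are occupied exactly up to height `cnt 0`. -/
theorem ray_flow {N M cnt : ℕ → ℕ} {occ : ℕ → Prop} [DecidablePred occ]
    (hcut : ∀ j, N j = M j + cnt j)
    (hbal : ∀ j, N (j + 1) ≤ M j + 1 ∧ M j ≤ N (j + 1) + 1)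
    (hN : ∀ j, ¬ occ j → N j = 0) (hM : ∀ j, ¬ occ (j + 1) → M j = 0)
    (hcnt : ∀ j, cnt j = cnt (j + 1) + if occ (j + 1) then 1 else 0) :
    ((cnt 0 : ℤ) * (cnt 0 - 1) ≤ 2 * N 0 ∧ (2 * N 0 : ℤ) ≤ cnt 0 * (cnt 0 + 3)) ∧
      (∀ j, 1 ≤ j → j ≤ cnt 0 → occ j) ∧ (0 < cnt 0 → occ 0) := by
  -- Sites beyond `j` force departures from `j`, and only occupied vertices have departures; so
  -- there are no gaps.
  have hocc : ∀ j, 0 < cnt j → occ j := fun j hj => by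
    by_contra h
    have := hN j h
    have := hcut j
    omega
  have hform : ∀ j, cnt j = cnt 0 - j := by
    intro j
    induction j with
    | zero => simp
    | succ j ih =>
      have h1 := hcnt j
      have h2 := hocc (j + 1)
      split_ifs at h1 with h3
      · omega
      · have : ¬ 0 < cnt (j + 1) := fun h => h3 (h2 h)
        omega
  have hocc' : ∀ j, 1 ≤ j → j ≤ cnt 0 → occ j := by
    intro j h1 h2
    obtain ⟨j, rfl⟩ := Nat.exists_eq_add_of_le' h1
    have h3 := hcnt j
    have h4 := hform j
    have h5 := hform (j + 1)
    by_contra h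
    rw [if_neg h] at h3
    omega
  refine ⟨?_, hocc', hocc 0⟩
  -- Here `i` counts down from the tip, where the flow is zero; going one vertex lower adds `i + 1`
  -- up to an error of one.
  have key : ∀ i, i ≤ cnt 0 → ((i : ℤ) * (i - 1) ≤ 2 * N (cnt 0 - i) ∧
      (2 * N (cnt 0 - i) : ℤ) ≤ i * (i + 3)) := by
    intro i
    induction i with
    | zero =>
      intro _
      have h1 := hform (cnt 0)
      have h2 := hcnt (cnt 0)
      have h3 : ¬ occ (cnt 0 + 1) := fun h => by rw [if_pos h] at h2; omega
      have h4 := hcut (cnt 0)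
      rw [hM _ h3, h1] at h4
      simp [h4]
    | succ i ih =>
      intro hi
      obtain ⟨h1, h2⟩ := ih (by omega)
      have h3 := hcut (cnt 0 - (i + 1))
      have h4 := hbal (cnt 0 - (i + 1))
      rw [hform (cnt 0 - (i + 1)), show cnt 0 - (cnt 0 - (i + 1)) = i + 1 by omega] at h3
      rw [show cnt 0 - (i + 1) + 1 = cnt 0 - i by omega] at h4
      generalize cnt 0 - (i + 1) = y at *
      generalize N (cnt 0 - i) = z at *
      push_cast
      have h5 : (N y : ℤ) = M y + (i + 1) := by exact_mod_cast h3
      have h6 : (z : ℤ) ≤ M y + 1 := by exact_mod_cast h4.1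
      have h7 : (M y : ℤ) ≤ z + 1 := by exact_mod_cast h4.2
      constructor <;> nlinarith
  simpa using key (cnt 0) le_rfl

end Tooth



/-! ### Teeth and backbone of the comb -/

section Comb

open Classical

variable {c : RotorSequence comb} {ρ₀ : RotorConfig comb} {A : Finset (ℤ × ℤ)}
  {σ : (ℤ × ℤ) × RotorConfig comb} {u : ℤ × ℤ → ℕ} {e : ℤ × ℤ → ℤ × ℤ → ℕ}

theorem comb_adj_vertical {s : ℤ} (hs : s = 1 ∨ s = -1) (x y : ℤ) :
    comb.Adj (x, y) (x, y + s) := by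
  left
  rcases hs with rfl | rfl <;> simp

theorem comb_adj_horizontal {s : ℤ} (hs : s = 1 ∨ s = -1) (x : ℤ) :
    comb.Adj (x, 0) (x + s, 0) := by
  right
  rcases hs with rfl | rfl <;> simp

theorem comb_adj_up {s : ℤ} (hs : s = 1 ∨ s = -1) (x : ℤ) (j : ℕ) :
    comb.Adj (x, s * j) (x, s * (j + 1)) := by
  rw [mul_add, mul_one]
  exact comb_adj_vertical hs x _

theorem comb_adj_out {s : ℤ} (hs : s = 1 ∨ s = -1) (j : ℕ) :
    comb.Adj (s * j, 0) (s * (j + 1), 0) := by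
  rw [mul_add, mul_one]
  exact comb_adj_horizontal hs _

theorem comb_adj_iff {a b a' b' : ℤ} : comb.Adj (a, b) (a', b') ↔
    (a = a' ∧ (b - b' = 1 ∨ b - b' = -1)) ∨ (b = 0 ∧ b' = 0 ∧ (a - a' = 1 ∨ a - a' = -1)) := by
  simp only [comb, abs_eq (zero_le_one : (0 : ℤ) ≤ 1)]

/-- The number of sites of `A` on the tooth at `x`, on the side `s`, beyond height `j`. -/
def toothCount (A : Finset (ℤ × ℤ)) (x s : ℤ) (j : ℕ) : ℕ :=
  {z ∈ A | z.1 = x ∧ (j : ℤ) < s * z.2}.card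

/-- The number of sites of `A` on the side `s` of the comb, beyond distance `j`. -/
def sideCount (A : Finset (ℤ × ℤ)) (s : ℤ) (j : ℕ) : ℕ :=
  {z ∈ A | (j : ℤ) < s * z.1}.card

theorem Ledger.tooth_cut (h : Ledger c (0, 0) ρ₀ A σ u e) {s : ℤ} (hs : s = 1 ∨ s = -1)
    (x : ℤ) (j : ℕ) :
    e (x, s * j) (x, s * (j + 1)) = e (x, s * (j + 1)) (x, s * j) + toothCount A x s j
      + if σ.1.1 = x ∧ (j : ℤ) < s * σ.1.2 then 1 else 0 := by
  have := h.cut {z | z.1 = x ∧ (j : ℤ) < s * z.2} (x, s * j) (x, s * (j + 1)) (by simp)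
    (by rcases hs with rfl | rfl <;> simp) (by rcases hs with rfl | rfl <;> simp) (by
      rintro ⟨a, b⟩ ⟨a', b'⟩ hadj hv hw
      rw [comb_adj_iff] at hadj
      simp only [Set.mem_ofPred_eq, Prod.mk.injEq] at *
      rcases hs with rfl | rfl <;> omega)
  simp only [Set.mem_ofPred_eq] at this
  rw [toothCount]
  convert this

theorem Ledger.side_cut (h : Ledger c (0, 0) ρ₀ A σ u e) {s : ℤ} (hs : s = 1 ∨ s = -1)
    (j : ℕ) :
    e (s * j, 0) (s * (j + 1), 0) = e (s * (j + 1), 0) (s * j, 0) + sideCount A s j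
      + if (j : ℤ) < s * σ.1.1 then 1 else 0 := by
  have := h.cut {z | (j : ℤ) < s * z.1} (s * j, 0) (s * (j + 1), 0) (by simp)
    (by rcases hs with rfl | rfl <;> simp) (by rcases hs with rfl | rfl <;> simp) (by
      rintro ⟨a, b⟩ ⟨a', b'⟩ hadj hv hw
      rw [comb_adj_iff] at hadj
      simp only [Set.mem_ofPred_eq, Prod.mk.injEq] at *
      rcases hs with rfl | rfl <;> omega)
  simp only [Set.mem_ofPred_eq] at this
  rw [sideCount]
  convert this

theorem toothCount_eq_add {s : ℤ} (hs : s = 1 ∨ s = -1) (A : Finset (ℤ × ℤ)) (x : ℤ) (j : ℕ) :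
    toothCount A x s j
      = toothCount A x s (j + 1) + if (x, s * ((j + 1 : ℕ) : ℤ)) ∈ A then 1 else 0 := by
  rw [toothCount, toothCount, Finset.card_filter, Finset.card_filter,
    ← Finset.sum_ite_eq' A (x, s * ((j + 1 : ℕ) : ℤ)) (fun _ => 1), ← Finset.sum_add_distrib]
  refine Finset.sum_congr rfl ?_
  rintro ⟨a, b⟩ _
  simp only [Prod.mk.injEq]
  rcases hs with rfl | rfl <;> split_ifs <;> omega

theorem sideCount_eq_add {s : ℤ} (hs : s = 1 ∨ s = -1) (A : Finset (ℤ × ℤ)) (j : ℕ) :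
    sideCount A s j
      = sideCount A s (j + 1) + {z ∈ A | z.1 = s * ((j + 1 : ℕ) : ℤ)}.card := by
  rw [sideCount, sideCount, Finset.card_filter, Finset.card_filter, Finset.card_filter,
    ← Finset.sum_add_distrib]
  refine Finset.sum_congr rfl ?_
  rintro ⟨a, b⟩ _
  rcases hs with rfl | rfl <;> split_ifs <;> simp_all <;> omega

theorem card_column (A : Finset (ℤ × ℤ)) (x : ℤ) :
    {z ∈ A | z.1 = x}.card
      = toothCount A x 1 0 + toothCount A x (-1) 0 + if (x, 0) ∈ A then 1 else 0 := by
  rw [toothCount, toothCount, Finset.card_filter, Finset.card_filter, Finset.card_filter,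
    ← Finset.sum_ite_eq' A (x, 0) (fun _ => 1), ← Finset.sum_add_distrib,
    ← Finset.sum_add_distrib]
  refine Finset.sum_congr rfl ?_
  rintro ⟨a, b⟩ _
  simp only [Prod.mk.injEq]
  split_ifs <;> omega

theorem card_eq_sides {s : ℤ} (hs : s = 1 ∨ s = -1) (A : Finset (ℤ × ℤ)) :
    A.card = sideCount A s 0 + sideCount A (-s) 0 + {z ∈ A | z.1 = 0}.card := by
  rw [sideCount, sideCount, Finset.card_filter, Finset.card_filter, Finset.card_filter,
    ← Finset.sum_add_distrib, ← Finset.sum_add_distrib, Finset.card_eq_sum_ones]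
  refine Finset.sum_congr rfl ?_
  rintro ⟨a, b⟩ _
  rcases hs with rfl | rfl <;> split_ifs <;> omega

theorem exists_side_mul_natAbs (y : ℤ) : ∃ s : ℤ, (s = 1 ∨ s = -1) ∧ y = s * y.natAbs := by
  rcases le_total 0 y with h | h
  · exact ⟨1, by simp, by omega⟩
  · exact ⟨-1, by simp, by omega⟩

/-- The number of steps made inside a finite subset of the comb is bounded. -/
theorem exists_sum_steps_le (c : RotorSequence comb) (ρ₀ : RotorConfig comb)
    (A : Finset (ℤ × ℤ)) :
    ∃ K, ∀ σ u e, Ledger c (0, 0) ρ₀ A σ u e → ∑ v ∈ A, u v ≤ K := by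
  set m := ∑ v ∈ A, v.2.natAbs + 1 with hm
  refine ⟨∑ v ∈ A, Nat.card (comb.neighborSet v) * (m * (A.card + 2) + 1), ?_⟩
  intro σ u e h
  refine Finset.sum_le_sum ?_
  rintro ⟨x, y⟩ hv
  obtain ⟨s, hs, hy⟩ := exists_side_mul_natAbs y
  rw [hy]
  generalize y.natAbs = j
  refine (h.steps_le (comb_adj_up hs x j)).trans ?_
  gcongr
  -- Going one vertex up the tooth lowers the flow by at most `A.card + 2`: the settled sites, the
  -- moving particle and the rotor error. After `m` vertices the walk up the tooth is outside `A`,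
  -- where the flow is zero.
  have hstep : ∀ i : ℕ, e (x, s * i) (x, s * (i + 1))
      ≤ e (x, s * ((i + 1 : ℕ) : ℤ)) (x, s * ((i + 1 : ℕ) + 1)) + (A.card + 2) := by
    intro i
    have h1 := h.tooth_cut hs x i
    have h2 : toothCount A x s i ≤ A.card := Finset.card_filter_le _ _
    have h3 := h.crossings_le (comb_adj_up hs x i).symm
      (by simpa using comb_adj_up hs x (i + 1))
    push_cast
    split_ifs at h1 <;> omega
  have hmany : ∀ i : ℕ, e (x, s * j) (x, s * (j + 1))
      ≤ e (x, s * ((j + i : ℕ) : ℤ)) (x, s * ((j + i : ℕ) + 1)) + i * (A.card + 2) := by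
    intro i
    induction i with
    | zero => simp
    | succ i ih =>
      have := hstep (j + i)
      rw [add_mul, one_mul, ← add_assoc j i 1]
      omega
  have hout : (x, s * ((j + m : ℕ) : ℤ)) ∉ A := by
    intro hmem
    have h1 := Finset.single_le_sum (f := fun v : ℤ × ℤ => v.2.natAbs) (fun _ _ => Nat.zero_le _)
      hmem
    have h2 : (s * ((j + m : ℕ) : ℤ)).natAbs = j + m := by
      rcases hs with rfl | rfl <;> omega
    dsimp only at h1
    omega
  have h1 := hmany m
  rwa [h.crossings_eq_zero _ hout, zero_add] at h1

theorem Ledger.tooth (h : Ledger c (0, 0) ρ₀ A σ u e) (hσ : σ.1 = (0, 0)) {s : ℤ}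
    (hs : s = 1 ∨ s = -1) (x : ℤ) :
    ((toothCount A x s 0 : ℤ) * (toothCount A x s 0 - 1) ≤ 2 * e (x, 0) (x, s) ∧
      (2 * e (x, 0) (x, s) : ℤ) ≤ toothCount A x s 0 * (toothCount A x s 0 + 3)) ∧
    (∀ j : ℕ, 1 ≤ j → j ≤ toothCount A x s 0 → (x, s * (j : ℤ)) ∈ A) ∧
    (0 < toothCount A x s 0 → (x, 0) ∈ A) := by
  have key := ray_flow (N := fun j => e (x, s * j) (x, s * (j + 1)))
    (M := fun j => e (x, s * (j + 1)) (x, s * j)) (cnt := toothCount A x s)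
    (occ := fun j => (x, s * (j : ℤ)) ∈ A)
    (fun j => by
      have h1 := h.tooth_cut hs x j
      rwa [hσ, if_neg (by simp only [mul_zero]; omega), add_zero] at h1)
    (fun j => by
      have h1 := (comb_adj_up hs x j).symm
      have h2 := comb_adj_up hs x (j + 1)
      push_cast at h2 ⊢
      exact ⟨h.crossings_le h2 h1, h.crossings_le h1 h2⟩)
    (fun j hj => h.crossings_eq_zero _ hj _)
    (fun j hj => h.crossings_eq_zero _ (by simpa using hj) _)
    (fun j => toothCount_eq_add hs A x j)
  simpa using key

/-- The number of sites of `A` over `(x, 0)` on the side `s` is controlled by the number of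
crossings of any edge at `(x, 0)`. -/
theorem Ledger.toothCount_bounds (h : Ledger c (0, 0) ρ₀ A σ u e) (hσ : σ.1 = (0, 0)) {s : ℤ}
    (hs : s = 1 ∨ s = -1) {x : ℤ} {w : ℤ × ℤ} (hw : comb.Adj (x, 0) w) :
    (toothCount A x s 0 : ℝ) * (toothCount A x s 0 - 1) ≤ 2 * e (x, 0) w + 2 ∧
      2 * (e (x, 0) w : ℝ) - 2 ≤ toothCount A x s 0 * (toothCount A x s 0 + 3) := by
  obtain ⟨h1, h2⟩ := (h.tooth hσ hs x).1
  have hadj : comb.Adj (x, 0) (x, s) := by simpa using comb_adj_vertical hs x 0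
  have h3 := h.crossings_le hw hadj
  have h4 := h.crossings_le hadj hw
  constructor
  · have : (toothCount A x s 0 : ℤ) * (toothCount A x s 0 - 1) ≤ 2 * e (x, 0) w + 2 := by omega
    exact_mod_cast this
  · have : 2 * (e (x, 0) w : ℤ) - 2 ≤ toothCount A x s 0 * (toothCount A x s 0 + 3) := by omega
    exact_mod_cast this

/-- A column is two tooth sides and a foot, so these are the one-sided bounds of `height_le` and
`le_height` doubled, plus one. They supply the growth hypotheses of the barriers. -/
theorem Ledger.column_bounds (h : Ledger c (0, 0) ρ₀ A σ u e) (hσ : σ.1 = (0, 0)) {x : ℤ}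
    {w : ℤ × ℤ} (hw : comb.Adj (x, 0) w) (hx : (x, 0) ∈ A) (t : ℝ) :
    (3 ≤ t → (e (x, 0) w : ℝ) ≤ t ^ 4 / 18 - t ^ 2 / 2 →
      ({z ∈ A | z.1 = x}.card : ℝ) ≤ 2 / 3 * t ^ 2 - 1) ∧
    (t ^ 4 / 18 + 2 * t ^ 2 / 3 + 2 ≤ (e (x, 0) w : ℝ) →
      2 / 3 * t ^ 2 + 2 ≤ ({z ∈ A | z.1 = x}.card : ℝ)) := by
  have h1 := h.toothCount_bounds hσ (Or.inl rfl) hw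
  have h2 := h.toothCount_bounds hσ (Or.inr rfl) hw
  rw [card_column, if_pos hx]
  push_cast
  constructor
  · intro ht ha
    linarith [height_le ht h1.1 ha, height_le ht h2.1 ha]
  · intro ha
    linarith [le_height (Nat.cast_nonneg _) h1.2 ha, le_height (Nat.cast_nonneg _) h2.2 ha]

theorem exists_sideCount_eq_zero (A : Finset (ℤ × ℤ)) (s : ℤ) : ∃ j, sideCount A s j = 0 := by
  refine ⟨∑ z ∈ A, (s * z.1).natAbs, ?_⟩
  rw [sideCount, Finset.card_eq_zero, Finset.filter_eq_empty_iff]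
  intro z hz
  have h1 := Finset.single_le_sum (f := fun z : ℤ × ℤ => (s * z.1).natAbs)
    (fun _ _ => Nat.zero_le _) hz
  omega

/-- On each side the cluster occupies an interval of the backbone, whose length `r` controls the
crossings of the backbone edges and the number of occupied sites on that side. -/
theorem Ledger.exists_extent (h : Ledger c (0, 0) ρ₀ A σ u e) (hσ : σ.1 = (0, 0))
    (ho : (0, 0) ∈ A) {s : ℤ} (hs : s = 1 ∨ s = -1) :
    ∃ r : ℕ, (∀ j ≤ r, (s * (j : ℤ), 0) ∈ A) ∧
      (e (0, 0) (s, 0) : ℝ) ≤ ((r : ℝ) + 3) ^ 4 / 18 - ((r : ℝ) + 3) ^ 2 / 2 ∧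
      (sideCount A s 0 : ℝ) ≤ (4 * ((r : ℝ) + 3) ^ 3 - 6 * ((r : ℝ) + 3) ^ 2
        + 4 * ((r : ℝ) + 3) - 1) / 18 - ((r : ℝ) + 3) - 1 / 2 ∧
      ∀ i j : ℕ, i + j + 3 = r → (i : ℝ) ^ 4 / 18 + 2 * (i : ℝ) ^ 2 / 3 + 2
        ≤ e (s * (j : ℤ), 0) (s * (j + 1), 0) := by
  set r := Nat.find (exists_sideCount_eq_zero A s) with hr
  have hr0 : sideCount A s r = 0 := Nat.find_spec (exists_sideCount_eq_zero A s)
  have hrpos : ∀ j < r, 0 < sideCount A s j := fun j hj =>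
    Nat.pos_of_ne_zero (Nat.find_min (exists_sideCount_eq_zero A s) hj)
  have hcut : ∀ j : ℕ, e (s * j, 0) (s * (j + 1), 0)
      = e (s * (j + 1), 0) (s * j, 0) + sideCount A s j := fun j => by
    have h1 := h.side_cut hs j
    rwa [hσ, if_neg (by simp only [mul_zero]; omega), add_zero] at h1
  have hcol : ∀ x : ℤ, 0 < {z ∈ A | z.1 = x}.card → (x, 0) ∈ A := by
    intro x hx
    by_contra hn
    have h1 := (h.tooth hσ (Or.inl rfl) x).2.2
    have h2 := (h.tooth hσ (Or.inr rfl) x).2.2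
    rw [card_column, if_neg hn] at hx
    have : 0 < toothCount A x 1 0 ∨ 0 < toothCount A x (-1) 0 := by omega
    exact this.elim (fun h => hn (h1 h)) (fun h => hn (h2 h))
  have hocc : ∀ j ≤ r, (s * (j : ℤ), 0) ∈ A := by
    intro j hj
    rcases Nat.eq_zero_or_pos j with rfl | hj0
    · simpa using ho
    obtain ⟨j, rfl⟩ : ∃ i, j = i + 1 := ⟨j - 1, by omega⟩
    rcases hj.lt_or_eq with hlt | heq
    · by_contra hn
      have h1 := hcut (j + 1)
      rw [h.crossings_eq_zero _ hn] at h1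
      have := hrpos _ hlt
      omega
    · apply hcol
      have h1 := sideCount_eq_add hs A j
      rw [heq, hr0] at h1
      rw [heq]
      have := hrpos j (by omega)
      omega
  have hnot : (s * ((r : ℤ) + 1), (0 : ℤ)) ∉ A := by
    intro hmem
    rw [sideCount, Finset.card_eq_zero, Finset.filter_eq_empty_iff] at hr0
    apply hr0 hmem
    rcases hs with rfl | rfl <;> omega
  have hend : e (s * r, 0) (s * (r + 1), 0) = 0 := by
    rw [hcut, hr0, h.crossings_eq_zero _ hnot]
  -- Indices run inward from the last occupied backbone site `r`, so that `a` and `S` start at zero.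
  set a : ℕ → ℝ := fun i => e (s * ((r - i : ℕ) : ℤ), 0) (s * (((r - i : ℕ) : ℤ) + 1), 0) with ha
  set S : ℕ → ℝ := fun i => sideCount A s (r - i) with hSdef
  set T : ℕ → ℝ := fun i => {z ∈ A | z.1 = s * ((r - i : ℕ) : ℤ)}.card with hTdef
  have hS : ∀ i < r, S (i + 1) = S i + T i := by
    intro i hi
    have h1 := sideCount_eq_add hs A (r - (i + 1))
    rw [show r - (i + 1) + 1 = r - i by omega] at h1
    simp only [hSdef, hTdef]
    exact_mod_cast h1
  have hstep : ∀ i < r, a (i + 1) ≤ a i + S (i + 1) + 1 ∧ a i + S (i + 1) - 1 ≤ a (i + 1) := by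
    intro i hi
    obtain ⟨j, hj⟩ : ∃ j, r - (i + 1) = j := ⟨_, rfl⟩
    have hj' : r - i = j + 1 := by omega
    have h1 := hcut j
    have h2 := (comb_adj_out hs j).symm
    have h3 := comb_adj_out hs (j + 1)
    push_cast at h3
    have h4 := h.crossings_le h2 h3
    have h5 := h.crossings_le h3 h2
    simp only [ha, hSdef, hj, hj', h1]
    push_cast
    have h4' := (Nat.cast_le (α := ℝ)).mpr h4
    have h5' := (Nat.cast_le (α := ℝ)).mpr h5
    push_cast at h4' h5'
    constructor <;> linarith
  have ha0 : a 0 = 0 := by simp [ha, hend]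
  have hS0 : S 0 = 0 := by simp [hSdef, hr0]
  have hTb : ∀ i, _ := fun i => h.column_bounds hσ (comb_adj_out hs (r - i))
    (hocc (r - i) (by omega))
  have hup := upper_barrier ha0 hS0 hS (fun i hi => (hstep i hi).1)
    (fun i _ t => (hTb i t).1) le_rfl
  refine ⟨r, hocc, ?_, ?_, ?_⟩
  · simpa [ha] using hup.1
  · simpa [hSdef] using hup.2
  · intro i j hij
    have hlow := lower_barrier (a := a) (fun i _ => Nat.cast_nonneg _) hS0 hS
      (fun i hi => (hstep i hi).2)
      (fun i _ =>
        Nat.one_le_cast.mpr (Finset.card_pos.mpr ⟨(s * ((r - i : ℕ) : ℤ), 0),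
          Finset.mem_filter.mpr ⟨hocc (r - i) (by omega), rfl⟩⟩))
      (fun i _ t => (hTb i t).2) (i := i) (by omega)
    have h1 := hlow.1
    simp only [ha] at h1
    rwa [show r - (i + 3) = j by omega] at h1

/-- The cluster reaches at least as far as `(9 n / 4) ^ (1 / 3) - 9` on each side. -/
theorem Ledger.exists_long_extent (h : Ledger c (0, 0) ρ₀ A σ u e) (hσ : σ.1 = (0, 0))
    (ho : (0, 0) ∈ A) {s : ℤ} (hs : s = 1 ∨ s = -1) :
    ∃ r : ℕ, 9 / 4 * (A.card : ℝ) ≤ ((r : ℝ) + 9) ^ 3 ∧ (∀ j ≤ r, (s * (j : ℤ), 0) ∈ A) ∧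
      ∀ i j : ℕ, i + j + 3 = r → (i : ℝ) ^ 4 / 18 + 2 * (i : ℝ) ^ 2 / 3 + 2
        ≤ e (s * (j : ℤ), 0) (s * (j + 1), 0) := by
  obtain ⟨r, hocc, ha, hS, hlow⟩ := h.exists_extent hσ ho hs
  have hs' : -s = 1 ∨ -s = -1 := by omega
  obtain ⟨r', -, -, hS', hlow'⟩ := h.exists_extent hσ ho hs'
  refine ⟨r, ?_, hocc, hlow⟩
  have hadj : comb.Adj (0, 0) (s, 0) := by simpa using comb_adj_horizontal hs 0
  have hadj' : comb.Adj (0, 0) (-s, 0) := by simpa using comb_adj_horizontal hs' 0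
  have hr0 : (0 : ℝ) ≤ r := Nat.cast_nonneg r
  -- The flows from the origin to the two sides differ by at most one. The lower barrier at `r' - 3`
  -- and the upper barrier at `r + 3` would contradict this if `r'` were larger.
  have hrr : (r' : ℝ) ≤ r + 6 := by
    by_contra hlt
    push Not at hlt
    have hlt' : r + 6 < r' := by exact_mod_cast hlt
    have h1 := hlow' (r' - 3) 0 (by omega)
    rw [Nat.cast_sub (by omega)] at h1
    simp only [Nat.cast_zero, mul_zero, zero_add, mul_one] at h1
    have h2 : (e (0, 0) (-s, 0) : ℝ) ≤ e (0, 0) (s, 0) + 1 := by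
      exact_mod_cast h.crossings_le hadj' hadj
    have h3 : ((r : ℝ) + 3) ^ 4 ≤ ((r' : ℝ) - 3) ^ 4 := by
      apply pow_le_pow_left₀ <;> linarith
    push_cast at h1
    nlinarith [sq_nonneg ((r' : ℝ) - 3), sq_nonneg ((r : ℝ) + 3)]
  have hT := (h.column_bounds hσ hadj ho (r + 3)).1 (by linarith) ha
  have hcard : (A.card : ℝ) = sideCount A s 0 + sideCount A (-s) 0
      + {z ∈ A | z.1 = 0}.card := by exact_mod_cast card_eq_sides hs A
  have hmono : (sideCount A (-s) 0 : ℝ) ≤ 2 / 9 * ((r : ℝ) + 9) ^ 3 := by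
    have h1 : ((r' : ℝ) + 3) ^ 3 ≤ ((r : ℝ) + 9) ^ 3 := by
      apply pow_le_pow_left₀ <;> linarith [(Nat.cast_nonneg r' : (0 : ℝ) ≤ r')]
    nlinarith [sq_nonneg ((r' : ℝ) + 3), (Nat.cast_nonneg r' : (0 : ℝ) ≤ r')]
  rw [hcard]
  nlinarith [sq_nonneg (r : ℝ), mul_nonneg hr0 (sq_nonneg (r : ℝ))]

end Comb

/-! ### Constants and the inner bound -/

section Main

theorem k_pos : 0 < k := by unfold k; positivity

theorem k_cube : k ^ 3 = 9 / 4 := by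
  rw [k, ← Real.rpow_natCast, ← Real.rpow_mul (by norm_num)]
  norm_num

theorem l_eq : l = k ^ 2 / 3 := by
  rw [k, l, ← Real.rpow_natCast, ← Real.rpow_mul (by norm_num),
    show (2 / 3 : ℝ) * (2 : ℕ) = 1 + 1 / 3 by norm_num, Real.rpow_add (by norm_num), Real.rpow_one]
  ring

theorem mem_cluster_of_mem_innerRegion {n : ℕ} (hn : 1 ≤ n) (c : RotorSequence comb)
    (ρ₀ : RotorConfig comb) {z : ℤ × ℤ} (hz : z ∈ innerRegion 1 1 (9 * k) n) :
    z ∈ cluster c ((0, 0) : ℤ × ℤ) ρ₀ n := by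
  obtain ⟨A, u, e, hA, hcard, ho, h⟩ :=
    exists_ledger c (0, 0) ρ₀ (exists_sum_steps_le c ρ₀) n
  rw [hA]
  obtain ⟨x, y⟩ := z
  obtain ⟨hx, hy⟩ := hz
  dsimp only at hx hy
  set m : ℝ := (n : ℝ) ^ (1 / 3 : ℝ) with hm
  have hm0 : 0 < m := by positivity
  have hm3 : m ^ 3 = n := by
    rw [hm, ← Real.rpow_natCast, ← Real.rpow_mul (Nat.cast_nonneg n)]
    norm_num
  have hq0 : 0 ≤ (n : ℝ) ^ (1 / 6 : ℝ) := by positivity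
  obtain ⟨s, hs, hxs⟩ := exists_side_mul_natAbs x
  obtain ⟨s', hs', hys⟩ := exists_side_mul_natAbs y
  obtain ⟨r, hr, hocc, hlow⟩ := h.exists_long_extent rfl (ho (by omega)) hs
  have hk := k_pos
  have hreach : k * m ≤ r + 9 := by
    refine le_of_pow_le_pow_left₀ three_ne_zero (by positivity) ?_
    rw [mul_pow, k_cube, hm3, ← hcard]
    exact hr
  rw [← Int.cast_abs, Int.abs_eq_natAbs, Int.cast_natCast] at hx hy
  rw [← Int.cast_abs, Int.abs_eq_natAbs, Int.cast_natCast] at hy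
  rw [hxs, hys]
  generalize x.natAbs = i at hx hy ⊢
  generalize y.natAbs = j at hy ⊢
  -- As `l = k ^ 2 / 3`, the prescribed profile is `t ^ 2 / 3` with `t = k m - i`.
  have hij : (j : ℝ) ≤ (k * m - i) ^ 2 / 3 + i - 9 * (k * m) := by
    have : l * (m - i / k) ^ 2 = (k * m - i) ^ 2 / 3 := by
      rw [l_eq]
      field_simp
    linarith
  have hi0 : (0 : ℝ) ≤ i := Nat.cast_nonneg i
  have hj0 : (0 : ℝ) ≤ j := Nat.cast_nonneg j
  have hkm : 0 < k * m := mul_pos hk hm0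
  -- The first condition gives `0 ≤ k m - i`. If this were at most `12`, the square term would be at
  -- most `4 k m`, and `i - 9 k m ≤ -8 k m` would make the height bound negative.
  have hfar : 12 < k * m - i := by
    by_contra hlt
    push Not at hlt
    nlinarith
  have hir : i + 3 ≤ r := by
    have : (i : ℝ) + 3 ≤ r := by linarith
    exact_mod_cast this
  rcases Nat.eq_zero_or_pos j with rfl | hjpos
  · simpa using hocc i (by omega)
  · apply (h.tooth rfl hs' (s * i)).2.1 j hjpos
    have h1 := hlow (r - 3 - i) i (by omega)
    have h2 := le_height (Nat.cast_nonneg _) (h.toothCount_bounds rfl hs' (comb_adj_out hs i)).2 h1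
    have h3 : ((r - 3 - i : ℕ) : ℝ) = r - 3 - i := by
      rw [Nat.cast_sub (by omega), Nat.cast_sub (by omega)]
      norm_num
    rw [h3] at h2
    -- The shift `12` is `9` from `hreach` plus `3` from the lower barrier. Expanding the square
    -- costs `8 (k m - i)`, which `9 k m - i` covers.
    have h4 : (k * m - i - 12) ^ 2 ≤ ((r : ℝ) - 3 - i) ^ 2 := by
      apply pow_le_pow_left₀ <;> linarith
    have : (j : ℝ) ≤ toothCount A (s * i) s' 0 := by nlinarith
    exact_mod_cast this

end Main

end RotorRouter

theorem theorem5p3 :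
    ∃ c₁ c₂ c₃ : ℝ, 0 < c₁ ∧ 0 < c₂ ∧ 0 < c₃ ∧ ∃ n₀ : ℕ, ∀ n : ℕ, n₀ ≤ n →
      ∀ (c : RotorRouter.RotorSequence RotorRouter.comb)
        (ρ₀ : RotorRouter.RotorConfig RotorRouter.comb),
        RotorRouter.innerRegion c₁ c₂ c₃ n ⊆ RotorRouter.cluster c ((0, 0) : ℤ × ℤ) ρ₀ n :=
  ⟨1, 1, 9 * RotorRouter.k, one_pos, one_pos, mul_pos (by norm_num) RotorRouter.k_pos, 1,
    fun _ hn c ρ₀ _ hz => RotorRouter.mem_cluster_of_mem_innerRegion hn c ρ₀ hz⟩
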